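/- **Setting.** Let $\mathcal A$ be a finite set, $D\ge 1$, and let $\mathfrak A\subset\mathcal A^{\mathbb Z^D}$ be a subshift (closed and invariant under the shifts $\sigma^{v}(\mathbf a)_z=a_{z+v}$). Write $\mathbb B(z,r)=z+\{-r,\dots,r\}^D$ and $|z|=\sum_i|z_i|$. For $\mathbf a\in\mathcal A^{\mathbb Z^D}$ let $F_{\mathbf a}(z)\in\mathbb N\cup\{\infty\}$ be the largest $r$ such that $\mathbf a_{\mathbb B(z,r)}$ is, up to translation, the restriction to $\mathbb B(0,r)$ of an element of $\mathfrak A$ ($0$ if there is none), and let $\mathbb G_r(\mathbf a)=\{z: F_{\mathbf a}(z)\ge r\}$. Let $\widetilde{\mathfrak A}=\{\mathbf a:\sup_z F_{\mathbf a}(z)=\infty\}$; $\mathbf a$ is *defective* if $\mathbf a\in\widetilde{\mathfrak A}\setminus\mathfrak A$. The defect of $\mathbf a\in\widetilde{\mathfrak A}$ is *essential* if there are no $r>0$ and $\mathbf a'\in\mathfrak A$ with $a'_z=a_z$ for all $z\in\mathbb G_r(\mathbf a)$. It is *$\Phi$-persistent*, for a cellular automaton $\Phi$, if $\Phi^t(\mathbf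 a)$ is defective for every $t\in\mathbb N$. Let $\mathcal G$ be a discrete group with a pseudonorm $|\cdot|:\mathcal G\to[0,\infty)$, that is, $|gh|=|hg|$ and $|gh|\le|g|+|h|$. A *cocycle* is a continuous $C:\mathbb Z^D\times\mathfrak A\to\mathcal G$ with $C(y+z,\mathbf x)=C(y,\sigma^z\mathbf x)\,C(z,\mathbf x)$. Cocycles $C,C'$ are cohomologous if $C'(z,\mathbf x)=b(\sigma^z\mathbf x)\,C(z,\mathbf x)\,b(\mathbf x)^{-1}$ for a continuous $b:\mathfrak A\to\mathcal G$; $H^1_{dy}(\mathfrak A,\mathcal G)$ is the set of cohomology classes. $C$ has radius $\rho$ if, for every unit vector $e=(0,\dots,\pm1,\dots,0)$, $C(e,\mathbf x)$ depends only on $\mathbf x_{\mathbb B(0,\rho)}$. If $\Phi$ is a cellular automaton with $\Phi(\mathfrak A)\subseteq\mathfrak A$, then $\Phi_*$ is the self-map of $H^1_{dy}(\mathfrak A,\mathcal G)$ induced by $(\Phi_*C)(z,\mathbf x)=C(z,\Phi(\mathbf x))$. A *trail* is a finite sequence of points of $\mathbb Z^D$ with successive distances $1$; components of subsets of $\mathbb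 Z^D$ are trail-connected components. A component $Y$ of $\mathbb G_r(\mathbf a)$ is *projective* if $Y\cap\mathbb G_R(\mathbf a)\ne\emptyset$ for all $R\ge r$. If $C$ has radius $\rho<r$, $\mathbf a\in\widetilde{\mathfrak A}$, and $Y$ is a component of $\mathbb G_r(\mathbf a)$ with $\pi_1(Y)=0$ (trails in $Y$ modulo replacing one interior vertex and inserting or deleting backtracks), let $C_{\mathbf a}(y,z)$, for $y,z\in Y$, be the product of the local rule of $C$ along any trail in $Y$ from $z$ to $y$. Then $\mathbf a$ has a *$C$-gap of range $r$* if $\mathbb G_r(\mathbf a)$ has two distinct projective components $Y_1,Y_2$ with $\pi_1(Y_1)=\pi_1(Y_2)=0$ and, for some $p_i\in Y_i$, $$\sup_{y_1\in Y_1,\;y_2\in Y_2}\frac{|C_{\mathbf a}(y_1,p_1)\,C_{\mathbf a}(p_2,y_2)|}{|y_1-y_2|}=\infty .$$ - $\mathbf a$ has a *$\mathcal G$-gap* if, for some $\mathcal G$-valued cocycle $C$, it has $C$-gaps of arbitrarily large range. - $\mathbf a$ has a *sharp $\mathcal G$-gap* if, for some $\mathcal G$-valued cocycle $C$ and some single $r$,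 it has a $C$-gap of range $r$; for every $r$ the set $\mathbb G_r(\mathbf a)$ has only finitely many projective components; and for all $R\ge r\ge0$ there is $K$ such that every $y\in\mathbb G_r(\mathbf a)$ is joined to some $x\in\mathbb G_R(\mathbf a)$ by a trail in $\mathbb G_r(\mathbf a)$ of length at most $K$. **Theorem.** Let $\mathbf a\in\mathcal A^{\mathbb Z^D}$ have a sharp $\mathcal G$-gap or a $\mathcal G$-gap. (a) The defect of $\mathbf a$ is essential. (b) If $\Phi:\mathcal A^{\mathbb Z^D}\to\mathcal A^{\mathbb Z^D}$ is a cellular automaton with $\Phi(\mathfrak A)\subseteq\mathfrak A$ and $\Phi_*:H^1_{dy}(\mathfrak A,\mathcal G)\to H^1_{dy}(\mathfrak A,\mathcal G)$ is surjective, then the defect of $\mathbf a$ is $\Phi$-persistent. -/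

import Mathlib

open scoped NNReal ENNReal

namespace CADefects

/-- The lattice `ℤ^D`. -/
abbrev Lat (D : ℕ) := Fin D → ℤ

/-- Configurations on `ℤ^D`, with the product topology when `A` is discrete. -/
abbrev Config (D : ℕ) (A : Type*) := Lat D → A

/-- The `ℓ¹` distance on `ℤ^D`. -/
def dist1 {D : ℕ} (y z : Lat D) : ℕ := ∑ i, (y i - z i).natAbs

/-- Two lattice points are adjacent if they differ by a unit vector `(0,…,±1,…,0)`. -/
def Adjacent {D : ℕ} (y z : Lat D) : Prop := dist1 y z = 1

/-- The cube `{-r,…,r}^D`. -/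
def cube (D r : ℕ) : Set (Lat D) := {v | ∀ i, |v i| ≤ (r : ℤ)}

/-- The shift: `(shift v a) z = a (z + v)`. -/
def shift {D : ℕ} {A : Type*} (v : Lat D) (a : Config D A) : Config D A := fun z => a (z + v)

/-- A subshift: a closed, shift-invariant set of configurations. -/
structure Subshift (D : ℕ) (A : Type*) [TopologicalSpace A] where
  carrier : Set (Config D A)
  isClosed : IsClosed carrier
  shift_mem : ∀ v, ∀ a ∈ carrier, shift v a ∈ carrier

/-- A cellular automaton: a continuous map commuting with all shifts. -/
structure CellularAutomaton (D : ℕ) (A : Type*) [TopologicalSpace A] where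
  toFun : Config D A → Config D A
  continuous : Continuous toFun
  comm : ∀ v a, toFun (shift v a) = shift v (toFun a)

namespace Subshift

variable {D : ℕ} {A : Type*} [TopologicalSpace A]

/-- The shift as a self-map of a subshift. -/
def shiftOn (S : Subshift D A) (v : Lat D) (x : S.carrier) : S.carrier :=
  ⟨shift v x.1, S.shift_mem v x.1 x.2⟩

/-- `x` and the translate of `a` by `z` agree on the cube of radius `r`. -/
def Matches (S : Subshift D A) (r : ℕ) (a : Config D A) (z : Lat D) (x : S.carrier) : Prop :=
  ∀ v ∈ cube D r, x.1 v = a (z + v)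

/-- The defect field: the largest `r` such that the block of `a` of radius `r` around `z`
occurs in an element of the subshift. -/
noncomputable def defectField (S : Subshift D A) (a : Config D A) (z : Lat D) : ℕ∞ :=
  sSup {n : ℕ∞ | ∃ r : ℕ, n = (r : ℕ∞) ∧ ∃ x, S.Matches r a z x}

/-- The points at which the defect field is at least `R`. -/
def unflawed (S : Subshift D A) (R : ℕ) (a : Config D A) : Set (Lat D) :=
  {z | (R : ℕ∞) ≤ S.defectField a z}

/-- The slightly defective configurations: those whose defect field is unbounded. -/
def slightlyDefective (S : Subshift D A) : Set (Config D A) :=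
  {a | ⨆ z, S.defectField a z = ⊤}

/-- Defective configurations. -/
def Defective (S : Subshift D A) (a : Config D A) : Prop :=
  a ∈ S.slightlyDefective ∧ a ∉ S.carrier

/-- The defect can be erased by changing `a` within a bounded distance of the flawed region. -/
def Removable (S : Subshift D A) (a : Config D A) : Prop :=
  ∃ r : ℕ, 0 < r ∧ ∃ a' ∈ S.carrier, ∀ z ∈ S.unflawed r a, a' z = a z

/-- `a` has an essential defect: it is slightly defective and its defect is not removable. -/
def Essential (S : Subshift D A) (a : Config D A) : Prop :=
  a ∈ S.slightlyDefective ∧ ¬ S.Removable a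

/-- `a` has a `Φ`-persistent defect: every `Φ^t a`, `t ∈ ℕ`, is defective. -/
def Persistent (S : Subshift D A) (Φ : CellularAutomaton D A) (a : Config D A) : Prop :=
  ∀ t : ℕ, S.Defective (Φ.toFun^[t] a)

end Subshift

section Trails

variable {D : ℕ}

/-- `ζ` is a trail inside `Y` from `x` to `y`. -/
structure IsTrail (Y : Set (Lat D)) (x y : Lat D) (ζ : List (Lat D)) : Prop where
  chain : ζ.IsChain Adjacent
  mem : ∀ z ∈ ζ, z ∈ Y
  head : ζ.head? = some x
  last : ζ.getLast? = some y

/-- `Y` is a trail-connected component of `T`. -/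
def IsComponent (T Y : Set (Lat D)) : Prop :=
  ∃ x ∈ T, Y = {y | ∃ ζ, IsTrail T x y ζ}

/-- Elementary homotopies of trails: replacing an interior vertex, or deleting or inserting a
backtrack. -/
inductive ElemHomotopy : List (Lat D) → List (Lat D) → Prop
  | swap (l m : List (Lat D)) (w x x' y : Lat D) :
      ElemHomotopy (l ++ w :: x :: y :: m) (l ++ w :: x' :: y :: m)
  | delete (l m : List (Lat D)) (w x : Lat D) :
      ElemHomotopy (l ++ w :: x :: w :: m) (l ++ w :: m)
  | insert (l m : List (Lat D)) (w x : Lat D) :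
      ElemHomotopy (l ++ w :: m) (l ++ w :: x :: w :: m)

/-- Homotopy, inside `Y`, of trails from `x` to `y`: a finite chain of trails in `Y`, successive
ones differing by an elementary homotopy. -/
def TrailHomotopic (Y : Set (Lat D)) (x y : Lat D) : List (Lat D) → List (Lat D) → Prop :=
  Relation.ReflTransGen
    (fun ζ ζ' => IsTrail Y x y ζ ∧ IsTrail Y x y ζ' ∧ ElemHomotopy ζ ζ')

/-- `π₁(Y) = 0`: every closed trail in `Y` is homotopic in `Y` to a constant trail. -/
def TrivialPi1 (Y : Set (Lat D)) : Prop :=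
  ∀ x ζ, IsTrail Y x x ζ → TrailHomotopic Y x x ζ [x]

end Trails

/-- A `G`-valued continuous dynamical cocycle on a subshift. -/
structure Cocycle {D : ℕ} {A : Type*} [TopologicalSpace A] (S : Subshift D A)
    (G : Type*) [Group G] [TopologicalSpace G] where
  toFun : Lat D → S.carrier → G
  continuous : Continuous fun p : Lat D × S.carrier => toFun p.1 p.2
  cocycle : ∀ y z x, toFun (y + z) x = toFun y (S.shiftOn z x) * toFun z x

namespace Cocycle

variable {D : ℕ} {A : Type*} [TopologicalSpace A] {S : Subshift D A}
  {G : Type*} [Group G] [TopologicalSpace G]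

/-- Two cocycles are cohomologous if they differ by a continuous transfer function. -/
def Cohomologous (C C' : Cocycle S G) : Prop :=
  ∃ b : S.carrier → G, Continuous b ∧
    ∀ z x, C'.toFun z x = b (S.shiftOn z x) * C.toFun z x * (b x)⁻¹

/-- `C` is locally determined with radius `ρ`: for every unit vector `e`, `C(e,x)` depends only
on the block of `x` in the cube of radius `ρ`. -/
def HasRadius (C : Cocycle S G) (ρ : ℕ) : Prop :=
  ∀ e, Adjacent 0 e → ∀ x y : S.carrier, (∀ v ∈ cube D ρ, x.1 v = y.1 v) →
    C.toFun e x = C.toFun e y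

open Classical in
/-- The local rule of `C`, of radius `r`, applied to the unit vector `e` and to the block of `a`
of radius `r` around `z`; it is meant for `z ∈ S.unflawed r a` and `C.HasRadius r`. -/
noncomputable def localRule (C : Cocycle S G) (r : ℕ) (a : Config D A) (e z : Lat D) : G :=
  if h : ∃ x, S.Matches r a z x then C.toFun e h.choose else 1

/-- The value of the local rule along a trail (later steps are multiplied on the left). -/
noncomputable def alongTrail (C : Cocycle S G) (r : ℕ) (a : Config D A) : List (Lat D) → G
  | [] => 1
  | [_] => 1
  | z :: w :: l => C.alongTrail r a (w :: l) * C.localRule r a (w - z) z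

open Classical in
/-- `C_a(y,z)` for `y, z` in a common component `Y`: the value of the local rule along any trail in
`Y` from `z` to `y`. -/
noncomputable def diffWithin (C : Cocycle S G) (r : ℕ) (a : Config D A) (Y : Set (Lat D))
    (y z : Lat D) : G :=
  if h : ∃ ζ, IsTrail Y z y ζ then C.alongTrail r a h.choose else 1

end Cocycle

/-- The set `H¹_dy(S,G)` of cohomology classes of continuous cocycles. -/
def cohomologySetoid {D : ℕ} {A : Type*} [TopologicalSpace A] (S : Subshift D A)
    (G : Type*) [Group G] [TopologicalSpace G] [IsTopologicalGroup G] : Setoid (Cocycle S G) where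
  r := Cocycle.Cohomologous
  iseqv :=
    { refl := fun C => ⟨fun _ => 1, continuous_const, by intros; simp⟩
      symm := by
        rintro C C' ⟨b, hb, h⟩
        refine ⟨fun x => (b x)⁻¹, hb.inv, fun z x => ?_⟩
        rw [h]; group
      trans := by
        rintro C C' C'' ⟨b, hb, h⟩ ⟨b', hb', h'⟩
        refine ⟨fun x => b' x * b x, hb'.mul hb, fun z x => ?_⟩
        rw [h', h]; group }

/-- The first dynamical cohomology of a subshift with coefficients in `G`. -/
def H1dy {D : ℕ} {A : Type*} [TopologicalSpace A] (S : Subshift D A)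
    (G : Type*) [Group G] [TopologicalSpace G] [IsTopologicalGroup G] : Type _ :=
  Quotient (cohomologySetoid S G)

namespace CellularAutomaton

variable {D : ℕ} {A : Type*} [TopologicalSpace A]

/-- `Φ(S) ⊆ S`. -/
def Preserves (Φ : CellularAutomaton D A) (S : Subshift D A) : Prop :=
  ∀ x ∈ S.carrier, Φ.toFun x ∈ S.carrier

/-- The restriction of `Φ` to a subshift which it preserves. -/
def restrict (Φ : CellularAutomaton D A) {S : Subshift D A} (h : Φ.Preserves S)
    (x : S.carrier) : S.carrier :=
  ⟨Φ.toFun x.1, h x.1 x.2⟩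

theorem continuous_restrict (Φ : CellularAutomaton D A) {S : Subshift D A} (h : Φ.Preserves S) :
    Continuous (Φ.restrict h) :=
  (Φ.continuous.comp continuous_subtype_val).subtype_mk _

theorem restrict_shiftOn (Φ : CellularAutomaton D A) {S : Subshift D A} (h : Φ.Preserves S)
    (z : Lat D) (x : S.carrier) :
    Φ.restrict h (S.shiftOn z x) = S.shiftOn z (Φ.restrict h x) :=
  Subtype.ext (Φ.comm z x.1)

variable {G : Type*} [Group G] [TopologicalSpace G]

/-- `(Φ_* C)(z,x) = C(z,Φ(x))`. -/
def pullCocycle (Φ : CellularAutomaton D A) {S : Subshift D A} (h : Φ.Preserves S)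
    (C : Cocycle S G) : Cocycle S G where
  toFun z x := C.toFun z (Φ.restrict h x)
  continuous := C.continuous.comp
    (continuous_fst.prodMk ((Φ.continuous_restrict h).comp continuous_snd))
  cocycle y z x := by rw [C.cocycle, Φ.restrict_shiftOn h]

/-- The map `Φ_*` induced by `Φ` on `H¹_dy(S,G)`. -/
def inducedMap [IsTopologicalGroup G] (Φ : CellularAutomaton D A) {S : Subshift D A}
    (h : Φ.Preserves S) : H1dy S G → H1dy S G :=
  Quotient.map (Φ.pullCocycle h) (by
    rintro C C' ⟨b, hb, hC⟩
    refine ⟨fun x => b (Φ.restrict h x), hb.comp (Φ.continuous_restrict h), fun z x => ?_⟩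
    simp only [pullCocycle, hC, Φ.restrict_shiftOn h])

end CellularAutomaton

/-- A pseudonorm on a group. It is finite-valued, as is any pseudonorm that is bounded on a finite
symmetric generating set. -/
structure Pseudonorm (G : Type*) [Group G] where
  toFun : G → ℝ≥0
  comm : ∀ g h, toFun (g * h) = toFun (h * g)
  subadd : ∀ g h, toFun (g * h) ≤ toFun g + toFun h

section Gaps

variable {D : ℕ} {A : Type*} [TopologicalSpace A] (S : Subshift D A)
  {G : Type*} [Group G] [TopologicalSpace G] (N : Pseudonorm G)

/-- `Y` is a projective component of `S.unflawed r a`. -/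
def IsProjectiveComponent (r : ℕ) (a : Config D A) (Y : Set (Lat D)) : Prop :=
  IsComponent (S.unflawed r a) Y ∧ ∀ R, r ≤ R → (Y ∩ S.unflawed R a).Nonempty

/-- For every range `r`, there are only finitely many projective components. -/
def FinitelyManyDomains (a : Config D A) : Prop :=
  ∀ r : ℕ, {Y | IsProjectiveComponent S r a Y}.Finite

variable {S}

/-- The tilt of `Y₁` relative to `Y₂`, with reference points `p₁` and `p₂`: the supremum of
`|C_a(y₁,y₂)| / |y₁ - y₂|`, where `C_a(y₁,y₂) = C_a(y₁,p₁) C_a(p₂,y₂)`. -/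
noncomputable def tilt (C : Cocycle S G) (r : ℕ) (a : Config D A) (Y₁ Y₂ : Set (Lat D))
    (p₁ p₂ : Lat D) : ℝ≥0∞ :=
  ⨆ y₁ ∈ Y₁, ⨆ y₂ ∈ Y₂,
    (N.toFun (C.diffWithin r a Y₁ y₁ p₁ * C.diffWithin r a Y₂ p₂ y₂) : ℝ≥0∞) / (dist1 y₁ y₂ : ℝ≥0∞)

/-- The domain boundary of range `r` in `a` is a `C`-gap: between two distinct simply connected
projective components of `S.unflawed r a`, the tilt is infinite. The range exceeds a radius of `C`,
so that the values of the local rule along homotopic trails coincide. -/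
def IsGapOfRange (C : Cocycle S G) (r : ℕ) (a : Config D A) : Prop :=
  a ∈ S.slightlyDefective ∧ (∃ ρ < r, C.HasRadius ρ) ∧
  ∃ Y₁ Y₂, IsProjectiveComponent S r a Y₁ ∧ IsProjectiveComponent S r a Y₂ ∧ Y₁ ≠ Y₂ ∧
    TrivialPi1 Y₁ ∧ TrivialPi1 Y₂ ∧
    ∃ p₁ ∈ Y₁, ∃ p₂ ∈ Y₂, tilt N C r a Y₁ Y₂ p₁ p₂ = ⊤

variable (S)

/-- Sharpness: for all `R ≥ r ≥ 0` there is `K` such that every point of `S.unflawed r a` is joined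
to a point of `S.unflawed R a` by a trail in `S.unflawed r a` with at most `K` steps. -/
def Sharp (a : Config D A) : Prop :=
  ∀ r R : ℕ, r ≤ R → ∃ K : ℕ, ∀ y ∈ S.unflawed r a, ∃ x ∈ S.unflawed R a,
    ∃ ζ, IsTrail (S.unflawed r a) y x ζ ∧ ζ.length ≤ K + 1

/-- `a` has a sharp gap, of some single range, for some `G`-valued cocycle. -/
def HasSharpGap (a : Config D A) : Prop :=
  Sharp S a ∧ FinitelyManyDomains S a ∧ ∃ (C : Cocycle S G) (r : ℕ), IsGapOfRange N C r a

/-- `a` has a `G`-gap: for some `G`-valued cocycle `C`, there are `C`-gaps of arbitrarily large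
range. -/
def HasGap (a : Config D A) : Prop :=
  ∃ C : Cocycle S G, ∀ r₀ : ℕ, ∃ r, r₀ ≤ r ∧ IsGapOfRange N C r a

end Gaps

end CADefects

/-!
Suppose the defect of `Φ(a)` is removable, and let `x` in the subshift agree with `Φ(a)` away from
the flawed region. For every cocycle `C'`, the orbit map `y ↦ C'(y, x)` is a primitive of `C'` along
the blocks of `Φ(a)`, hence a primitive of `Φ_* C'` along the blocks of `a`, and it grows at most
linearly because `x` has no defect. Surjectivity of `Φ_*` makes every `C` cohomologous to some
`Φ_* C'`, and multiplying by the transfer function gives a primitive `h` of `C` along the blocks of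
`a` of some radius `R`, still of linear growth.

On a simply connected component of range `r`, the map `y ↦ C_a(y, p)` is another primitive of `C`,
so it has the form `h(y) k` with `k` constant, provided that `R ≤ r`: this is the case of gaps of
arbitrarily large range. For a sharp gap of range `r < R`, every point of the component is within
bounded trail distance of the unflawed region of range `R`, which has finitely many components, and
so finitely many constants `k` suffice. In both cases `C_a(y₁, p₁) C_a(p₂, y₂)` is
`u₁ h(x₁) k₁ k₂⁻¹ h(x₂)⁻¹ u₂⁻¹`, with bounded factors and `xᵢ` at bounded distance from `yᵢ`. Since
`|gh| = |hg|`, the inner factor may be split off at the cost of its own pseudonorm, which makes the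
tilt finite. The identity automaton gives (a), and the iterates of `Φ` give (b).
-/

namespace CADefects

section Lattice

variable {D : ℕ}

theorem dist1_self (y : Lat D) : dist1 y y = 0 := by simp [dist1]

theorem dist1_comm (y z : Lat D) : dist1 y z = dist1 z y :=
  Finset.sum_congr rfl fun _ _ => by omega

theorem dist1_triangle (x y z : Lat D) : dist1 x z ≤ dist1 x y + dist1 y z := by
  simp only [dist1, ← Finset.sum_add_distrib]
  exact Finset.sum_le_sum fun _ _ => by omega

theorem dist1_eq_zero {y z : Lat D} : dist1 y z = 0 ↔ y = z := by
  simp [dist1, funext_iff, sub_eq_zero]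

theorem abs_sub_le_dist1 (y z : Lat D) (i : Fin D) : |y i - z i| ≤ dist1 y z := by
  rw [Int.abs_eq_natAbs, Int.ofNat_le]
  exact Finset.single_le_sum (f := fun i => (y i - z i).natAbs) (fun _ _ => Nat.zero_le _)
    (Finset.mem_univ i)

theorem Adjacent.symm {y z : Lat D} (h : Adjacent y z) : Adjacent z y := by
  rwa [Adjacent, dist1_comm]

theorem Adjacent.zero_sub {y z : Lat D} (h : Adjacent y z) : Adjacent 0 (z - y) := by
  simpa [Adjacent, dist1, ← Int.natAbs_neg (z _ - y _)] using h

theorem cube_mono {r s : ℕ} (h : r ≤ s) : cube D r ⊆ cube D s :=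
  fun _ hv i => (hv i).trans (Int.ofNat_le.2 h)

theorem add_mem_cube {r s : ℕ} {v w : Lat D} (hv : v ∈ cube D r) (hw : w ∈ cube D s) :
    v + w ∈ cube D (r + s) := fun i =>
  (abs_add_le _ _).trans ((add_le_add (hv i) (hw i)).trans_eq (Nat.cast_add r s).symm)

theorem mem_cube_dist1_zero (v : Lat D) : v ∈ cube D (dist1 v 0) := fun i => by
  simpa using abs_sub_le_dist1 v 0 i

theorem Adjacent.mem_cube_one {e : Lat D} (h : Adjacent 0 e) : e ∈ cube D 1 :=
  h.symm ▸ mem_cube_dist1_zero e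

theorem finite_cube (D r : ℕ) : (cube D r).Finite :=
  (Set.finite_Icc (fun _ => -(r : ℤ)) fun _ => (r : ℤ)).subset fun _ hv =>
    ⟨fun i => (abs_le.1 (hv i)).1, fun i => (abs_le.1 (hv i)).2⟩

instance finite_unitVectors : Finite {e : Lat D // Adjacent 0 e} :=
  ((finite_cube D 1).subset fun _ => Adjacent.mem_cube_one).to_subtype

theorem exists_adjacent_dist1 {x y : Lat D} {n : ℕ} (h : dist1 x y = n + 1) :
    ∃ w, Adjacent x w ∧ dist1 w y = n := by
  obtain ⟨i, hi⟩ : ∃ i, y i - x i ≠ 0 := by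
    by_contra! hxy
    have heq : x = y := funext fun i => (sub_eq_zero.1 (hxy i)).symm
    exact n.succ_ne_zero (h.symm.trans (dist1_eq_zero.2 heq))
  refine ⟨x + Pi.single i (y i - x i).sign, ?_, ?_⟩
  · rw [Adjacent, dist1, Finset.sum_eq_single i (fun j _ hj => by simp [hj]) (by simp)]
    simp [Int.natAbs_sign_of_ne_zero hi]
  · rw [dist1, ← Finset.add_sum_erase _ _ (Finset.mem_univ i)] at h ⊢
    have hrest : ∀ j ∈ Finset.univ.erase i,
        ((x + Pi.single i (y i - x i).sign : Lat D) j - y j).natAbs = (x j - y j).natAbs :=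
      fun j hj => by simp [Finset.ne_of_mem_erase hj]
    have hstep :
        ((x + Pi.single i (y i - x i).sign : Lat D) i - y i).natAbs + 1 = (x i - y i).natAbs := by
      rw [Pi.add_apply, Pi.single_eq_same]
      rcases hi.lt_or_gt with hlt | hgt
      · rw [Int.sign_eq_neg_one_of_neg hlt]
        omega
      · rw [Int.sign_eq_one_of_pos hgt]
        omega
    rw [Finset.sum_congr rfl hrest]
    omega

end Lattice

section Trails

variable {D : ℕ} {T Y Z : Set (Lat D)} {x y z : Lat D} {ζ ξ : List (Lat D)}

namespace IsTrail

theorem mono (h : IsTrail Y x y ζ) (hY : Y ⊆ T) : IsTrail T x y ζ :=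
  ⟨h.chain, fun z hz => hY (h.mem z hz), h.head, h.last⟩

theorem inter (h : IsTrail Y x y ζ) (h' : IsTrail Z x y ζ) : IsTrail (Y ∩ Z) x y ζ :=
  ⟨h.chain, fun z hz => ⟨h.mem z hz, h'.mem z hz⟩, h.head, h.last⟩

theorem singleton (hx : x ∈ Y) : IsTrail Y x x [x] :=
  ⟨by simp, by simpa using hx, rfl, rfl⟩

theorem cons (hx : x ∈ Y) (hxy : Adjacent x y) (h : IsTrail Y y z ζ) :
    IsTrail Y x z (x :: ζ) := by
  obtain ⟨ζ, rfl⟩ : ∃ ξ, ζ = y :: ξ := ⟨_, List.eq_cons_of_mem_head? h.head⟩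
  exact ⟨h.chain.cons_cons hxy, by simpa [hx] using h.mem, rfl, by simpa using h.last⟩

theorem pair (hx : x ∈ Y) (hy : y ∈ Y) (hxy : Adjacent x y) : IsTrail Y x y [x, y] :=
  (singleton hy).cons hx hxy

@[elab_as_elim]
theorem head_induction_on {motive : ∀ x ζ, IsTrail Y x y ζ → Prop} {x : Lat D}
    {ζ : List (Lat D)} (h : IsTrail Y x y ζ)
    (singleton : ∀ hy : y ∈ Y, motive y [y] (.singleton hy))
    (cons : ∀ {x w ζ} (hx : x ∈ Y) (hxw : Adjacent x w) (hζ : IsTrail Y w y (w :: ζ)),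
      motive w (w :: ζ) hζ → motive x (x :: w :: ζ) (hζ.cons hx hxw)) : motive x ζ h := by
  induction ζ generalizing x with
  | nil => simpa using h.head
  | cons u ζ ih =>
    obtain rfl : u = x := by simpa using h.head
    cases ζ with
    | nil =>
      obtain rfl : u = y := by simpa using h.last
      exact singleton (h.mem u (by simp))
    | cons w ζ =>
      have hζ : IsTrail Y w y (w :: ζ) :=
        ⟨h.chain.tail, fun z hz => h.mem z (List.mem_cons_of_mem _ hz), rfl, by simpa using h.last⟩
      exact cons (h.mem u (by simp)) (List.isChain_cons_cons.1 h.chain).1 hζ (ih hζ)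

theorem left_mem (h : IsTrail Y x y ζ) : x ∈ Y :=
  h.mem x (List.mem_of_mem_head? h.head)

theorem right_mem (h : IsTrail Y x y ζ) : y ∈ Y :=
  h.mem y (List.mem_of_mem_getLast? h.last)

theorem trans (h : IsTrail Y x y ζ) (h' : IsTrail Y y z ξ) : IsTrail Y x z (ζ ++ ξ.tail) := by
  induction h using IsTrail.head_induction_on with
  | singleton _ => rwa [List.singleton_append, ← List.eq_cons_of_mem_head? h'.head]
  | cons hx hxw _ ih => exact ih.cons hx hxw

theorem reverse (h : IsTrail Y x y ζ) : IsTrail Y y x ζ.reverse where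
  chain := List.isChain_reverse.2 (h.chain.imp fun _ _ h => h.symm)
  mem z hz := h.mem z (List.mem_reverse.1 hz)
  head := by rw [List.head?_reverse, h.last]
  last := by rw [List.getLast?_reverse, h.head]

theorem dist1_lt_length (h : IsTrail Y x y ζ) : dist1 x y < ζ.length := by
  induction h using IsTrail.head_induction_on with
  | singleton _ => simp [dist1_self]
  | @cons x w ζ _ hxw _ ih =>
    have htri := dist1_triangle x w y
    rw [show dist1 x w = 1 from hxw] at htri
    simp only [List.length_cons] at ih ⊢
    omega

end IsTrail

theorem exists_isTrail_univ_length (x y : Lat D) :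
    ∃ ζ, IsTrail Set.univ x y ζ ∧ ζ.length = dist1 x y + 1 := by
  generalize hn : dist1 x y = n
  induction n generalizing x with
  | zero =>
    obtain rfl := dist1_eq_zero.1 hn
    exact ⟨[x], .singleton trivial, rfl⟩
  | succ n ih =>
    obtain ⟨w, hxw, hw⟩ := exists_adjacent_dist1 hn
    obtain ⟨ζ, hζ, hlen⟩ := ih w hw
    exact ⟨x :: ζ, hζ.cons trivial hxw, congrArg Nat.succ hlen⟩

namespace IsComponent

theorem nonempty (hY : IsComponent T Y) : Y.Nonempty := by
  obtain ⟨x, hx, rfl⟩ := hY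
  exact ⟨x, _, .singleton hx⟩

theorem subset (hY : IsComponent T Y) : Y ⊆ T := by
  obtain ⟨x, _, rfl⟩ := hY
  exact fun y ⟨ζ, h⟩ => h.right_mem

theorem mem_of_adjacent (hY : IsComponent T Y) (hy : y ∈ Y) (hz : z ∈ T) (h : Adjacent y z) :
    z ∈ Y := by
  obtain ⟨x, _, rfl⟩ := hY
  obtain ⟨ζ, hζ⟩ := hy
  exact ⟨_, hζ.trans (.pair hζ.right_mem hz h)⟩

theorem restrict_trail (hY : IsComponent T Y) (hx : x ∈ Y) (h : IsTrail T x y ζ) :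
    IsTrail Y x y ζ := by
  induction h using IsTrail.head_induction_on with
  | singleton _ => exact .singleton hx
  | cons _ hxw hζ ih => exact (ih (hY.mem_of_adjacent hx hζ.left_mem hxw)).cons hx hxw

theorem exists_trail (hY : IsComponent T Y) (hy : y ∈ Y) (hz : z ∈ Y) :
    ∃ ζ, IsTrail Y y z ζ := by
  obtain ⟨x, _, rfl⟩ := id hY
  obtain ⟨ζ, hζ⟩ := id hy
  obtain ⟨ξ, hξ⟩ := hz
  exact ⟨_, hY.restrict_trail hy (hζ.reverse.trans hξ)⟩

theorem subset_of_mem (hY : IsComponent T Y) (hZ : IsComponent T Z) (hxY : x ∈ Y) (hxZ : x ∈ Z) :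
    Y ⊆ Z := fun _ hy => by
  obtain ⟨ζ, hζ⟩ := hY.exists_trail hxY hy
  exact (hZ.restrict_trail hxZ (hζ.mono hY.subset)).right_mem

theorem disjoint (hY : IsComponent T Y) (hZ : IsComponent T Z) (hne : Y ≠ Z) : Disjoint Y Z :=
  Set.disjoint_left.2 fun _ hxY hxZ =>
    hne ((hY.subset_of_mem hZ hxY hxZ).antisymm (hZ.subset_of_mem hY hxZ hxY))

end IsComponent

theorem finite_image_of_finite_components {X : Type*} {g : Lat D → X}
    (hT : {Z | IsComponent T Z}.Finite) (hY : Y ⊆ T)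
    (hg : ∀ x ∈ Y, ∀ y ∈ Y, ∀ ζ, IsTrail T x y ζ → g x = g y) : (g '' Y).Finite := by
  have hsub : ∀ Z, IsComponent T Z → (g '' (Y ∩ Z)).Subsingleton := by
    rintro Z hZ _ ⟨x, ⟨hxY, hxZ⟩, rfl⟩ _ ⟨y, ⟨hyY, hyZ⟩, rfl⟩
    obtain ⟨ζ, hζ⟩ := hZ.exists_trail hxZ hyZ
    exact hg x hxY y hyY ζ (hζ.mono hZ.subset)
  refine (hT.biUnion fun Z hZ => (hsub Z hZ).finite).subset ?_
  rintro _ ⟨x, hx, rfl⟩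
  have hZ : IsComponent T {y | ∃ ζ, IsTrail T x y ζ} := ⟨x, hY hx, rfl⟩
  exact Set.mem_biUnion hZ ⟨x, ⟨hx, _, .singleton (hY hx)⟩, rfl⟩

end Trails

section Windows

theorem exists_finset_determining {ι A X B : Type*} [TopologicalSpace A] [DiscreteTopology A]
    [TopologicalSpace X] [CompactSpace X] {π : X → ι → A} (hπ : Topology.IsInducing π)
    [TopologicalSpace B] [DiscreteTopology B] {f : X → B} (hf : Continuous f) :
    ∃ I : Finset ι, ∀ x y, (∀ i ∈ I, π x i = π y i) → f x = f y := by
  classical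
  have hlocal : ∀ x, ∃ I : Finset ι, ∀ y, (∀ i ∈ I, π y i = π x i) → f y = f x := fun x => by
    have hx : f ⁻¹' {f x} ∈ nhds x := hf.continuousAt.preimage_mem_nhds (by simp)
    obtain ⟨t, ht, htf⟩ := (hπ.nhds_eq_comap x ▸ hx :)
    rw [nhds_pi, Filter.mem_pi'] at ht
    obtain ⟨I, u, hu, hIu⟩ := ht
    exact ⟨I, fun y hy => htf (hIu fun i hi => (hy i hi).symm ▸ mem_of_mem_nhds (hu i))⟩
  choose I hI using hlocal
  have hnhds : ∀ x, {y | ∀ i ∈ I x, π y i = π x i} ∈ nhds x := fun x => by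
    rw [hπ.nhds_eq_comap x]
    refine ⟨(I x : Set ι).pi fun i => {π x i}, set_pi_mem_nhds (I x).finite_toSet fun i _ => ?_,
      fun y hy i hi => hy i hi⟩
    exact mem_nhds_discrete.2 rfl
  obtain ⟨t, ht⟩ := CompactSpace.elim_nhds_subcover _ hnhds
  refine ⟨t.biUnion I, fun x y hxy => ?_⟩
  obtain ⟨c, hc, hxc⟩ := Set.mem_iUnion₂.1 (ht.ge (Set.mem_univ x))
  have hyc : ∀ i ∈ I c, π y i = π c i := fun i hi =>
    (hxy i (Finset.mem_biUnion.2 ⟨c, hc, hi⟩)).symm.trans (hxc i hi)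
  rw [hI c x hxc, hI c y hyc]

theorem exists_radius {D : ℕ} {A X B : Type*} [TopologicalSpace A] [DiscreteTopology A]
    [TopologicalSpace X] [CompactSpace X] {π : X → Config D A} (hπ : Topology.IsInducing π)
    [TopologicalSpace B] [DiscreteTopology B] {f : X → B} (hf : Continuous f) :
    ∃ r : ℕ, ∀ x y, (∀ v ∈ cube D r, π x v = π y v) → f x = f y := by
  obtain ⟨I, hI⟩ := exists_finset_determining hπ hf
  exact ⟨I.sup (dist1 · 0), fun x y hxy => hI x y fun v hv =>
    hxy v (cube_mono (Finset.le_sup hv) (mem_cube_dist1_zero v))⟩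

end Windows

namespace Subshift

section Blocks

variable {D : ℕ} {A : Type*} [TopologicalSpace A] {S : Subshift D A} {a : Config D A}
  {r s : ℕ} {u z w : Lat D} {x : S.carrier}

theorem Matches.mono (h : S.Matches s a z x) (hrs : r ≤ s) : S.Matches r a z x :=
  fun v hv => h v (cube_mono hrs hv)

theorem Matches.shiftOn (h : S.Matches (r + s) a z x) (hu : u ∈ cube D s) :
    S.Matches r a (z + u) (S.shiftOn u x) := fun v hv => by
  rw [add_assoc, add_comm u v, ← h _ (add_mem_cube hv hu)]
  rfl

theorem Matches.shiftOn_sub (h : S.Matches (r + 1) a z x) (hzw : Adjacent z w) :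
    S.Matches r a w (S.shiftOn (w - z) x) := by
  simpa using h.shiftOn hzw.zero_sub.mem_cube_one

theorem Matches.mem_unflawed (h : S.Matches r a z x) : z ∈ S.unflawed r a :=
  show (r : ℕ∞) ≤ S.defectField a z from le_sSup ⟨r, rfl, x, h⟩

theorem exists_matches (hr : 0 < r) (hz : z ∈ S.unflawed r a) : ∃ x, S.Matches r a z x := by
  have hlt : ((r - 1 : ℕ) : ℕ∞) < S.defectField a z :=
    (Nat.cast_lt.2 (Nat.sub_lt hr one_pos)).trans_le hz
  obtain ⟨_, ⟨s, rfl, x, hx⟩, hs⟩ := lt_sSup_iff.1 hlt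
  exact ⟨x, hx.mono (Nat.le_of_pred_lt (Nat.cast_lt.1 hs))⟩

theorem unflawed_anti (h : r ≤ s) : S.unflawed s a ⊆ S.unflawed r a :=
  fun _ hz => le_trans (show (r : ℕ∞) ≤ s from Nat.cast_le.2 h) hz

theorem mem_slightlyDefective_iff :
    a ∈ S.slightlyDefective ↔ ∀ n, (S.unflawed n a).Nonempty := by
  refine ⟨fun h n => ?_, fun h => ENat.eq_top_iff_forall_ge.2 fun n => ?_⟩
  · obtain ⟨z, hz⟩ := lt_iSup_iff.1 ((ENat.natCast_lt_top n).trans_eq (Eq.symm h))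
    exact ⟨z, hz.le⟩
  · obtain ⟨z, hz⟩ := h n
    exact hz.trans (le_iSup _ z)

theorem Essential.defective (h : S.Essential a) : S.Defective a :=
  ⟨h.1, fun ha => h.2 ⟨1, one_pos, a, ha, fun _ _ => rfl⟩⟩

end Blocks

variable {D : ℕ} {A : Type*} [TopologicalSpace A] [Finite A] {S : Subshift D A}

instance compactSpace_carrier : CompactSpace S.carrier :=
  isCompact_iff_compactSpace.1 S.isClosed.isCompact

theorem exists_block_code [DiscreteTopology A] {B : Type*} [TopologicalSpace B]
    [DiscreteTopology B] [Nonempty B] {b : S.carrier → B} (hb : Continuous b) :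
    ∃ s, ∀ a, ∃ β : Lat D → B,
      (Set.range β).Finite ∧ ∀ z x, S.Matches s a z x → b x = β z := by
  obtain ⟨s, hs⟩ := exists_radius .subtypeVal hb
  obtain ⟨c⟩ := ‹Nonempty B›
  have hfin : (insert c (Set.range b)).Finite := (isCompact_range hb).finite_of_discrete.insert c
  refine ⟨s, fun a => ?_⟩
  have hex : ∀ z, ∃ g ∈ insert c (Set.range b), ∀ x, S.Matches s a z x → b x = g := fun z => by
    by_cases hz : ∃ x, S.Matches s a z x
    · obtain ⟨x₀, hx₀⟩ := hz
      exact ⟨b x₀, .inr ⟨x₀, rfl⟩, fun x hx => hs x x₀ fun v hv => (hx v hv).trans (hx₀ v hv).symm⟩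
    · exact ⟨c, .inl rfl, fun x hx => (hz ⟨x, hx⟩).elim⟩
  choose β hβ hbβ using hex
  exact ⟨β, hfin.subset (Set.range_subset_iff.2 hβ), hbβ⟩

end Subshift

namespace CellularAutomaton

variable {D : ℕ} {A : Type*} [TopologicalSpace A] {S : Subshift D A}

/-- The cellular automaton `Φ^t`. -/
def iterate (Φ : CellularAutomaton D A) (t : ℕ) : CellularAutomaton D A where
  toFun := Φ.toFun^[t]
  continuous := Φ.continuous.iterate t
  comm v := Function.Commute.iterate_left (Φ.comm v) t

theorem Preserves.iterate {Φ : CellularAutomaton D A} (hΦ : Φ.Preserves S) (t : ℕ) :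
    (Φ.iterate t).Preserves S :=
  Set.MapsTo.iterate (f := Φ.toFun) hΦ t

theorem inducedMap_iterate {G : Type*} [Group G] [TopologicalSpace G] [IsTopologicalGroup G]
    (Φ : CellularAutomaton D A) (hΦ : Φ.Preserves S) (t : ℕ) :
    ((Φ.iterate t).inducedMap (hΦ.iterate t) : H1dy S G → H1dy S G) = (Φ.inducedMap hΦ)^[t] := by
  induction t with
  | zero => exact funext (Quotient.ind fun _ => rfl)
  | succ t ih =>
    rw [Function.iterate_succ', ← ih]
    exact funext (Quotient.ind fun _ => rfl)

variable [Finite A] [DiscreteTopology A]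

theorem exists_window (Φ : CellularAutomaton D A) : ∃ q, ∀ (x y : Config D A) (u v : Lat D),
    (∀ w ∈ cube D q, x (u + w) = y (v + w)) → Φ.toFun x u = Φ.toFun y v := by
  obtain ⟨q, hq⟩ := exists_radius .id ((continuous_apply (0 : Lat D)).comp Φ.continuous)
  have hshift : ∀ (x : Config D A) (u : Lat D), Φ.toFun x u = Φ.toFun (shift u x) 0 :=
    fun x u => by rw [Φ.comm, shift, zero_add]
  refine ⟨q, fun x y u v h => ?_⟩
  rw [hshift x, hshift y]
  exact hq _ _ fun w hw => by simpa only [id, shift, add_comm] using h w hw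

theorem exists_matches_restrict (Φ : CellularAutomaton D A) (hΦ : Φ.Preserves S) :
    ∃ q, ∀ m a z x, S.Matches (m + q) a z x → S.Matches m (Φ.toFun a) z (Φ.restrict hΦ x) := by
  obtain ⟨q, hq⟩ := Φ.exists_window
  refine ⟨q, fun m a z x hx v hv => hq _ _ _ _ fun w hw => ?_⟩
  rw [hx _ (add_mem_cube hv hw), add_assoc]

theorem toFun_mem_slightlyDefective (Φ : CellularAutomaton D A) (hΦ : Φ.Preserves S)
    {a : Config D A} (ha : a ∈ S.slightlyDefective) : Φ.toFun a ∈ S.slightlyDefective := by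
  obtain ⟨q, hq⟩ := Φ.exists_matches_restrict hΦ
  rw [Subshift.mem_slightlyDefective_iff] at ha ⊢
  intro n
  obtain ⟨z, hz⟩ := ha (n + q + 1)
  obtain ⟨x, hx⟩ := Subshift.exists_matches (Nat.succ_pos _) hz
  exact ⟨z, (hq n a z x (hx.mono (Nat.le_succ _))).mem_unflawed⟩

end CellularAutomaton

namespace Pseudonorm

variable {G : Type*} [Group G] {N : Pseudonorm G} {B B' : ℝ≥0} {g h : G}

theorem conj_le (N : Pseudonorm G) (u g v : G) :
    N.toFun (u * g * v) ≤ N.toFun (u * v) + N.toFun g := by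
  rw [N.comm, ← mul_assoc, N.comm u v]
  exact N.subadd _ _

/-- The elements `g` for which `|g|` and `|g⁻¹|` are both at most `B`; a pseudonorm need not be
invariant under inversion. -/
def ball (N : Pseudonorm G) (B : ℝ≥0) : Set G := {g | N.toFun g ≤ B ∧ N.toFun g⁻¹ ≤ B}

theorem mul_mem_ball (hg : g ∈ N.ball B) (hh : h ∈ N.ball B') : g * h ∈ N.ball (B + B') := by
  refine ⟨(N.subadd _ _).trans (add_le_add hg.1 hh.1), ?_⟩
  rw [mul_inv_rev, N.comm]
  exact (N.subadd _ _).trans (add_le_add hg.2 hh.2)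

theorem inv_mem_ball (hg : g ∈ N.ball B) : g⁻¹ ∈ N.ball B :=
  ⟨hg.2, (inv_inv g).symm ▸ hg.1⟩

theorem ball_mono (h : B ≤ B') : N.ball B ⊆ N.ball B' :=
  fun _ hg => ⟨hg.1.trans h, hg.2.trans h⟩

theorem exists_subset_ball (N : Pseudonorm G) {T : Set G} (hT : T.Finite) : ∃ B, T ⊆ N.ball B := by
  obtain ⟨B, hB⟩ := (hT.image fun g => N.toFun g ⊔ N.toFun g⁻¹).bddAbove
  exact ⟨B, fun g hg => sup_le_iff.1 (hB ⟨g, hg, rfl⟩)⟩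

end Pseudonorm

section Growth

variable {D : ℕ} {G : Type*} [Group G] {N : Pseudonorm G} {Y Y₁ Y₂ : Set (Lat D)}
  {f f₁ f₂ h β : Lat D → G}

theorem IsTrail.mul_inv_mem_ball {x y : Lat D} {ζ : List (Lat D)} {M : ℝ≥0}
    (hone : 1 ∈ N.ball M)
    (hstep : ∀ z ∈ Y, ∀ w ∈ Y, Adjacent z w → h w * (h z)⁻¹ ∈ N.ball M)
    (hζ : IsTrail Y x y ζ) : h y * (h x)⁻¹ ∈ N.ball (M * ζ.length) := by
  induction hζ using IsTrail.head_induction_on with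
  | singleton _ => simpa using hone
  | @cons x w ζ hx hxw hζ ih =>
    have hmul := Pseudonorm.mul_mem_ball ih (hstep x hx w hζ.left_mem hxw)
    rw [mul_assoc, inv_mul_cancel_left] at hmul
    rwa [List.length_cons, Nat.cast_add_one, mul_add_one]

/-- The quotients `h y * (h z)⁻¹` grow at most linearly with the distance from `y` to `z`. -/
def LinearGrowth (N : Pseudonorm G) (h : Lat D → G) : Prop :=
  ∃ M B : ℝ≥0, ∀ y z, N.toFun (h y * (h z)⁻¹) ≤ M * dist1 y z + B

theorem LinearGrowth.mul_left (hh : LinearGrowth N h) (hβ : (Set.range β).Finite) :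
    LinearGrowth N fun y => β y * h y := by
  obtain ⟨M, B, hMB⟩ := hh
  obtain ⟨B', hB'⟩ := N.exists_subset_ball hβ
  refine ⟨M, B + (B' + B'), fun y z => ?_⟩
  calc N.toFun (β y * h y * (β z * h z)⁻¹)
      = N.toFun (β y * (h y * (h z)⁻¹) * (β z)⁻¹) := by group
    _ ≤ N.toFun (β y * (β z)⁻¹) + N.toFun (h y * (h z)⁻¹) := N.conj_le _ _ _
    _ ≤ (B' + B') + (M * dist1 y z + B) :=
      add_le_add (Pseudonorm.mul_mem_ball (hB' ⟨y, rfl⟩)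
        (Pseudonorm.inv_mem_ball (hB' ⟨z, rfl⟩))).1 (hMB y z)
    _ = M * dist1 y z + (B + (B' + B')) := by ring

/-- On `Y`, the function `f` agrees with `h` up to moving the argument by a bounded distance and
multiplying by bounded factors on both sides. -/
def Tracks (N : Pseudonorm G) (Y : Set (Lat D)) (f h : Lat D → G) : Prop :=
  ∃ (K : ℕ) (B : ℝ≥0), ∀ y ∈ Y, ∃ x, dist1 y x ≤ K ∧
    ∃ u ∈ N.ball B, ∃ k ∈ N.ball B, f y = u * h x * k

theorem Tracks.exists_linear_bound (hh : LinearGrowth N h) (h₁ : Tracks N Y₁ f₁ h)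
    (h₂ : Tracks N Y₂ f₂ h) : ∃ M B : ℝ≥0, ∀ y₁ ∈ Y₁, ∀ y₂ ∈ Y₂,
      N.toFun (f₁ y₁ * (f₂ y₂)⁻¹) ≤ M * dist1 y₁ y₂ + B := by
  obtain ⟨M, B, hMB⟩ := hh
  obtain ⟨K₁, B₁, hB₁⟩ := h₁
  obtain ⟨K₂, B₂, hB₂⟩ := h₂
  refine ⟨M, M * (K₁ + K₂) + B + 2 * (B₁ + B₂), fun y₁ hy₁ y₂ hy₂ => ?_⟩
  obtain ⟨x₁, hd₁, u₁, hu₁, k₁, hk₁, hf₁⟩ := hB₁ y₁ hy₁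
  obtain ⟨x₂, hd₂, u₂, hu₂, k₂, hk₂, hf₂⟩ := hB₂ y₂ hy₂
  have hdist : dist1 x₁ x₂ ≤ dist1 y₁ y₂ + (K₁ + K₂) := by
    have htri := dist1_triangle x₁ y₁ x₂
    have htri' := dist1_triangle y₁ y₂ x₂
    rw [dist1_comm x₁ y₁] at htri
    omega
  calc N.toFun (f₁ y₁ * (f₂ y₂)⁻¹)
      = N.toFun (u₁ * (h x₁ * (k₁ * k₂⁻¹) * (h x₂)⁻¹) * u₂⁻¹) := by rw [hf₁, hf₂]; group
    _ ≤ N.toFun (u₁ * u₂⁻¹) + (N.toFun (h x₁ * (h x₂)⁻¹) + N.toFun (k₁ * k₂⁻¹)) :=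
      (N.conj_le _ _ _).trans (add_le_add_right (N.conj_le _ _ _) _)
    _ ≤ (B₁ + B₂) + ((M * dist1 x₁ x₂ + B) + (B₁ + B₂)) :=
      add_le_add (Pseudonorm.mul_mem_ball hu₁ (Pseudonorm.inv_mem_ball hu₂)).1
        (add_le_add (hMB x₁ x₂) (Pseudonorm.mul_mem_ball hk₁ (Pseudonorm.inv_mem_ball hk₂)).1)
    _ ≤ (B₁ + B₂) + ((M * (dist1 y₁ y₂ + (K₁ + K₂)) + B) + (B₁ + B₂)) := by
      gcongr
      exact_mod_cast hdist
    _ = M * dist1 y₁ y₂ + (M * (K₁ + K₂) + B + 2 * (B₁ + B₂)) := by ring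

end Growth

namespace Cocycle

variable {D : ℕ} {A : Type*} [TopologicalSpace A] {S : Subshift D A}
  {G : Type*} [Group G] [TopologicalSpace G]

theorem zero_apply (C : Cocycle S G) (x : S.carrier) : C.toFun 0 x = 1 := by
  have hx : S.shiftOn 0 x = x := Subtype.ext (funext fun z => congrArg x.1 (add_zero z))
  simpa [hx] using C.cocycle 0 0 x

theorem sub_apply (C : Cocycle S G) (y z : Lat D) (x : S.carrier) :
    C.toFun (y - z) (S.shiftOn z x) = C.toFun y x * (C.toFun z x)⁻¹ := by
  rw [eq_mul_inv_iff_mul_eq, ← C.cocycle, sub_add_cancel]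

theorem continuous_apply (C : Cocycle S G) (e : Lat D) : Continuous (C.toFun e) :=
  C.continuous.comp (.prodMk_right e)

section Finite

variable [Finite A] [DiscreteTopology G]

theorem exists_hasRadius [DiscreteTopology A] (C : Cocycle S G) : ∃ ρ, C.HasRadius ρ := by
  obtain ⟨ρ, hρ⟩ := exists_radius .subtypeVal
    (continuous_pi fun e : {e : Lat D // Adjacent 0 e} => C.continuous_apply e)
  exact ⟨ρ, fun e he x y hxy => congrFun (hρ x y hxy) ⟨e, he⟩⟩

theorem exists_step_bound (C : Cocycle S G) (N : Pseudonorm G) :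
    ∃ M, 1 ∈ N.ball M ∧ ∀ e, Adjacent 0 e → ∀ x, C.toFun e x ∈ N.ball M := by
  have hfin : (⋃ e : {e : Lat D // Adjacent 0 e}, Set.range (C.toFun e)).Finite :=
    Set.finite_iUnion fun e => (isCompact_range (C.continuous_apply e)).finite_of_discrete
  obtain ⟨M, hM⟩ := N.exists_subset_ball (hfin.insert 1)
  exact ⟨M, hM (.inl rfl), fun e he x => hM (.inr (Set.mem_iUnion.2 ⟨⟨e, he⟩, x, rfl⟩))⟩

theorem linearGrowth_orbit (C : Cocycle S G) (N : Pseudonorm G) (x : S.carrier) :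
    LinearGrowth N fun y => C.toFun y x := by
  obtain ⟨M, hone, hM⟩ := C.exists_step_bound N
  refine ⟨M, M, fun y z => ?_⟩
  obtain ⟨ζ, hζ, hlen⟩ := exists_isTrail_univ_length z y
  have hball := hζ.mul_inv_mem_ball (h := fun y => C.toFun y x) hone fun z _ w _ hzw =>
    C.sub_apply w z x ▸ hM _ hzw.zero_sub _
  rw [hlen, dist1_comm, Nat.cast_add_one, mul_add_one] at hball
  exact hball.1

end Finite

section LocalRule

variable {C : Cocycle S G} {r ρ : ℕ} {a : Config D A} {Y : Set (Lat D)} {x y z w : Lat D}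
  {ζ ξ : List (Lat D)}

theorem localRule_eq (hC : C.HasRadius ρ) (hρ : ρ ≤ r) {e : Lat D} (he : Adjacent 0 e)
    {s : S.carrier} (hs : S.Matches r a z s) : C.localRule r a e z = C.toFun e s := by
  have h : ∃ x, S.Matches r a z x := ⟨s, hs⟩
  rw [localRule, dif_pos h]
  exact hC e he _ _ fun v hv =>
    (h.choose_spec v (cube_mono hρ hv)).trans (hs v (cube_mono hρ hv)).symm

theorem localRule_mul_localRule (hC : C.HasRadius ρ) (hρ : ρ < r) (hzw : Adjacent z w)
    (hwy : Adjacent w y) {s : S.carrier} (hs : S.Matches r a z s) (hw : w ∈ S.unflawed r a) :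
    C.localRule r a (y - w) w * C.localRule r a (w - z) z = C.toFun (y - z) s := by
  obtain ⟨s', hs'⟩ := Subshift.exists_matches (Nat.zero_lt_of_lt hρ) hw
  have hshift : S.Matches ρ a w (S.shiftOn (w - z) s) := (hs.mono hρ).shiftOn_sub hzw
  have hagree : C.toFun (y - w) s' = C.toFun (y - w) (S.shiftOn (w - z) s) :=
    hC _ hwy.zero_sub _ _ fun v hv => (hs' v (cube_mono hρ.le hv)).trans (hshift v hv).symm
  rw [localRule_eq hC hρ.le hzw.zero_sub hs, localRule_eq hC hρ.le hwy.zero_sub hs', hagree,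
    ← C.cocycle, sub_add_sub_cancel]

theorem alongTrail_append (l m : List (Lat D)) (z : Lat D) :
    C.alongTrail r a (l ++ z :: m) = C.alongTrail r a (z :: m) * C.alongTrail r a (l ++ [z]) := by
  induction l with
  | nil => simp [alongTrail]
  | cons u l ih =>
    cases l with
    | nil => simp [alongTrail]
    | cons v l =>
      simp only [List.cons_append, alongTrail] at ih ⊢
      rw [ih, mul_assoc]

theorem alongTrail_trans (hζ : IsTrail Y x y ζ) (hξ : IsTrail Y y z ξ) :
    C.alongTrail r a (ζ ++ ξ.tail) = C.alongTrail r a ξ * C.alongTrail r a ζ := by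
  obtain ⟨l, rfl⟩ := List.getLast?_eq_some_iff.1 hζ.last
  rw [List.append_assoc, List.singleton_append, alongTrail_append,
    ← List.eq_cons_of_mem_head? hξ.head]

theorem alongTrail_two_steps (hC : C.HasRadius ρ) (hρ : ρ < r) (hY : Y ⊆ S.unflawed r a)
    {l m : List (Lat D)} {u : Lat D} (hζ : IsTrail Y x y (l ++ z :: w :: u :: m))
    {s : S.carrier} (hs : S.Matches r a z s) : C.alongTrail r a (l ++ z :: w :: u :: m) =
      C.alongTrail r a (u :: m) * C.toFun (u - z) s * C.alongTrail r a (l ++ [z]) := by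
  have hchain := (List.isChain_append.1 hζ.chain).2.1
  simp only [List.isChain_cons_cons] at hchain
  rw [alongTrail_append, alongTrail, alongTrail, mul_assoc (C.alongTrail r a (u :: m)),
    localRule_mul_localRule hC hρ hchain.1 hchain.2.1 hs (hY (hζ.mem w (by simp)))]

theorem alongTrail_eq_of_elemHomotopy (hC : C.HasRadius ρ) (hρ : ρ < r)
    (hY : Y ⊆ S.unflawed r a) (hζ : IsTrail Y x y ζ) (hξ : IsTrail Y x y ξ)
    (h : ElemHomotopy ζ ξ) : C.alongTrail r a ζ = C.alongTrail r a ξ := by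
  have hmatches : ∀ z ∈ Y, ∃ s, S.Matches r a z s := fun z hz =>
    Subshift.exists_matches (Nat.zero_lt_of_lt hρ) (hY hz)
  have hbacktrack : ∀ {l m : List (Lat D)} {z w}, IsTrail Y x y (l ++ z :: w :: z :: m) →
      C.alongTrail r a (l ++ z :: w :: z :: m) = C.alongTrail r a (l ++ z :: m) := by
    intro l m z w hζ
    obtain ⟨s, hs⟩ := hmatches z (hζ.mem z (by simp))
    rw [alongTrail_two_steps hC hρ hY hζ hs, sub_self, C.zero_apply, mul_one, ← alongTrail_append]
  cases h with
  | swap l m z =>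
    obtain ⟨s, hs⟩ := hmatches z (hζ.mem z (by simp))
    rw [alongTrail_two_steps hC hρ hY hζ hs, alongTrail_two_steps hC hρ hY hξ hs]
  | delete => exact hbacktrack hζ
  | insert => exact (hbacktrack hξ).symm

theorem alongTrail_eq_of_trailHomotopic (hC : C.HasRadius ρ) (hρ : ρ < r)
    (hY : Y ⊆ S.unflawed r a) (h : TrailHomotopic Y x y ζ ξ) :
    C.alongTrail r a ζ = C.alongTrail r a ξ := by
  induction h with
  | refl => rfl
  | tail _ h ih => exact ih.trans (alongTrail_eq_of_elemHomotopy hC hρ hY h.1 h.2.1 h.2.2)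

theorem alongTrail_eq_of_trivialPi1 (hC : C.HasRadius ρ) (hρ : ρ < r)
    (hY : Y ⊆ S.unflawed r a) (hπ : TrivialPi1 Y) (hζ : IsTrail Y x y ζ) (hξ : IsTrail Y x y ξ) :
    C.alongTrail r a ζ = C.alongTrail r a ξ := by
  have hloop : ∀ η, IsTrail Y x y η →
      C.alongTrail r a ξ.reverse * C.alongTrail r a η = 1 := fun η hη => by
    rw [← alongTrail_trans hη hξ.reverse]
    exact alongTrail_eq_of_trailHomotopic hC hρ hY (hπ x _ (hη.trans hξ.reverse))
  exact mul_left_cancel ((hloop ζ hζ).trans (hloop ξ hξ).symm)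

theorem diffWithin_eq_alongTrail (hC : C.HasRadius ρ) (hρ : ρ < r) (hY : Y ⊆ S.unflawed r a)
    (hπ : TrivialPi1 Y) (hζ : IsTrail Y x y ζ) :
    C.diffWithin r a Y y x = C.alongTrail r a ζ := by
  have h : ∃ ζ, IsTrail Y x y ζ := ⟨ζ, hζ⟩
  rw [diffWithin, dif_pos h]
  exact alongTrail_eq_of_trivialPi1 hC hρ hY hπ h.choose_spec hζ

theorem diffWithin_mul_diffWithin (hC : C.HasRadius ρ) (hρ : ρ < r) (hY : Y ⊆ S.unflawed r a)
    (hπ : TrivialPi1 Y) (hζ : IsTrail Y x y ζ) (hξ : IsTrail Y y z ξ) :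
    C.diffWithin r a Y z y * C.diffWithin r a Y y x = C.diffWithin r a Y z x := by
  rw [diffWithin_eq_alongTrail hC hρ hY hπ hζ, diffWithin_eq_alongTrail hC hρ hY hπ hξ,
    diffWithin_eq_alongTrail hC hρ hY hπ (hζ.trans hξ), alongTrail_trans hζ hξ]

theorem inv_diffWithin (hC : C.HasRadius ρ) (hρ : ρ < r) (hY : Y ⊆ S.unflawed r a)
    (hπ : TrivialPi1 Y) (hζ : IsTrail Y x y ζ) :
    (C.diffWithin r a Y y x)⁻¹ = C.diffWithin r a Y x y := by
  refine inv_eq_of_mul_eq_one_left ?_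
  rw [diffWithin_mul_diffWithin hC hρ hY hπ hζ hζ.reverse]
  exact diffWithin_eq_alongTrail hC hρ hY hπ (.singleton hζ.left_mem)

end LocalRule

/-- `h` is a primitive of `C` on `Y`: across each edge `z → w` of `Y`, the value of `C` in the
block of `a` of radius `r` around `z` is the quotient `h w * (h z)⁻¹`. -/
def IsPotentialOn (C : Cocycle S G) (r : ℕ) (a : Config D A) (Y : Set (Lat D))
    (h : Lat D → G) : Prop :=
  ∀ z ∈ Y, ∀ w ∈ Y, Adjacent z w → ∀ x, S.Matches r a z x → C.toFun (w - z) x = h w * (h z)⁻¹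

variable {C : Cocycle S G} {r R ρ : ℕ} {a : Config D A} {Y Y' : Set (Lat D)} {h h' : Lat D → G}
  {N : Pseudonorm G}

theorem isPotentialOn_diffWithin (hC : C.HasRadius ρ) (hρ : ρ < r)
    (hY : IsComponent (S.unflawed r a) Y) (hπ : TrivialPi1 Y) {p : Lat D} (hp : p ∈ Y) :
    C.IsPotentialOn r a Y fun y => C.diffWithin r a Y y p := by
  intro z hz w hw hzw x hx
  obtain ⟨ζ, hζ⟩ := hY.exists_trail hp hz
  beta_reduce
  rw [eq_mul_inv_iff_mul_eq, ← localRule_eq hC hρ.le hzw.zero_sub hx,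
    ← diffWithin_mul_diffWithin hC hρ hY.subset hπ hζ (.pair hz hw hzw),
    diffWithin_eq_alongTrail hC hρ hY.subset hπ (.pair hz hw hzw), alongTrail, alongTrail, one_mul]

namespace IsPotentialOn

theorem mono (hh : C.IsPotentialOn r a Y h) (hrR : r ≤ R) (hY : Y' ⊆ Y) :
    C.IsPotentialOn R a Y' h :=
  fun z hz w hw hzw x hx => hh z (hY hz) w (hY hw) hzw x (hx.mono hrR)

theorem inv_mul_eq (hh : C.IsPotentialOn r a Y h) (hh' : C.IsPotentialOn r a Y h') (hr : 0 < r)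
    (hY : Y ⊆ S.unflawed r a) {x y : Lat D} {ζ : List (Lat D)} (hζ : IsTrail Y x y ζ) :
    (h x)⁻¹ * h' x = (h y)⁻¹ * h' y := by
  induction hζ using IsTrail.head_induction_on with
  | singleton _ => rfl
  | @cons x w ζ hx hxw hζ ih =>
    obtain ⟨s, hs⟩ := Subshift.exists_matches hr (hY hx)
    have hstep : h w * (h x)⁻¹ = h' w * (h' x)⁻¹ :=
      (hh x hx w hζ.left_mem hxw s hs).symm.trans (hh' x hx w hζ.left_mem hxw s hs)
    rw [← ih, mul_inv_eq_iff_eq_mul.1 hstep]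
    group

theorem exists_bound_along_trails [Finite A] [DiscreteTopology G] (N : Pseudonorm G)
    (hh : C.IsPotentialOn r a Y h) (hr : 0 < r) (hY : Y ⊆ S.unflawed r a) :
    ∃ M, ∀ x y ζ, IsTrail Y x y ζ → h y * (h x)⁻¹ ∈ N.ball (M * ζ.length) := by
  obtain ⟨M, hone, hM⟩ := C.exists_step_bound N
  refine ⟨M, fun x y ζ hζ => hζ.mul_inv_mem_ball hone fun z hz w hw hzw => ?_⟩
  obtain ⟨s, hs⟩ := Subshift.exists_matches hr (hY hz)
  exact hh z hz w hw hzw s hs ▸ hM _ hzw.zero_sub s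

theorem exists_of_removable [Finite A] [DiscreteTopology A] [DiscreteTopology G]
    (C : Cocycle S G) (ha : S.Removable a) :
    ∃ R x, C.IsPotentialOn R a (S.unflawed R a) fun y => C.toFun y x := by
  obtain ⟨r, -, a', ha', heq⟩ := ha
  obtain ⟨ρ, hρ⟩ := C.exists_hasRadius
  refine ⟨r + ρ, ⟨a', ha'⟩, fun z _ w _ hzw x hx => ?_⟩
  rw [← C.sub_apply]
  refine hρ _ hzw.zero_sub _ _ fun v hv => ?_
  rw [hx v (cube_mono (Nat.le_add_left ρ r) hv), ← heq _ (hx.shiftOn hv).mem_unflawed, add_comm]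
  rfl

theorem pullCocycle [Finite A] [DiscreteTopology A] {Φ : CellularAutomaton D A}
    (hΦ : Φ.Preserves S) (hh : C.IsPotentialOn R (Φ.toFun a) (S.unflawed R (Φ.toFun a)) h) :
    ∃ R', (Φ.pullCocycle hΦ C).IsPotentialOn R' a (S.unflawed R' a) h := by
  obtain ⟨q, hq⟩ := Φ.exists_matches_restrict hΦ
  have hmem : ∀ z ∈ S.unflawed (R + q + 1) a, z ∈ S.unflawed R (Φ.toFun a) := fun z hz => by
    obtain ⟨x, hx⟩ := Subshift.exists_matches (Nat.succ_pos _) hz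
    exact (hq R a z x (hx.mono (Nat.le_succ _))).mem_unflawed
  exact ⟨R + q + 1, fun z hz w hw hzw x hx =>
    hh z (hmem z hz) w (hmem w hw) hzw _ (hq R a z x (hx.mono (Nat.le_succ _)))⟩

theorem of_cohomologous [Finite A] [DiscreteTopology A] [DiscreteTopology G] {C' : Cocycle S G}
    (hCC' : C.Cohomologous C') (hh : C.IsPotentialOn r a (S.unflawed r a) h) :
    ∃ R, ∃ β : Lat D → G, (Set.range β).Finite ∧
      C'.IsPotentialOn R a (S.unflawed R a) fun y => β y * h y := by
  obtain ⟨b, hb, hbC⟩ := hCC'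
  obtain ⟨s, hs⟩ := Subshift.exists_block_code hb
  obtain ⟨β, hβfin, hβ⟩ := hs a
  refine ⟨max r (s + 1), β, hβfin, fun z hz w hw hzw x hx => ?_⟩
  have hxs : S.Matches (s + 1) a z x := hx.mono (le_max_right _ _)
  rw [hbC, hβ w _ (hxs.shiftOn_sub hzw), hβ z x (hxs.mono (Nat.le_succ s)),
    hh.mono (le_max_left _ _) (Subshift.unflawed_anti (le_max_left _ _)) z hz w hw hzw x hx]
  group

end IsPotentialOn

end Cocycle

section Gaps

variable {D : ℕ} {A : Type*} [TopologicalSpace A] {S : Subshift D A}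
  {G : Type*} [Group G] [TopologicalSpace G] {N : Pseudonorm G} {C : Cocycle S G} {r R : ℕ}
  {a : Config D A} {Y : Set (Lat D)} {f h : Lat D → G}

theorem tilt_ne_top {Y₁ Y₂ : Set (Lat D)} {p₁ p₂ : Lat D} {M B : ℝ≥0} (hdisj : Disjoint Y₁ Y₂)
    (hbound : ∀ y₁ ∈ Y₁, ∀ y₂ ∈ Y₂, N.toFun
      (C.diffWithin r a Y₁ y₁ p₁ * C.diffWithin r a Y₂ p₂ y₂) ≤ M * dist1 y₁ y₂ + B) :
    tilt N C r a Y₁ Y₂ p₁ p₂ ≠ ⊤ := by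
  refine ne_top_of_le_ne_top (ENNReal.coe_ne_top (r := M + B))
    (iSup₂_le fun y₁ hy₁ => iSup₂_le fun y₂ hy₂ => ENNReal.div_le_of_le_mul ?_)
  have hdist : (1 : ℝ≥0) ≤ dist1 y₁ y₂ := Nat.one_le_cast.2 (Nat.one_le_iff_ne_zero.2 fun hd =>
    hdisj.ne_of_mem hy₁ hy₂ (dist1_eq_zero.1 hd))
  have hle := calc
    N.toFun (C.diffWithin r a Y₁ y₁ p₁ * C.diffWithin r a Y₂ p₂ y₂)
    _ ≤ M * dist1 y₁ y₂ + B := hbound y₁ hy₁ y₂ hy₂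
    _ ≤ M * dist1 y₁ y₂ + B * dist1 y₁ y₂ := by gcongr; exact le_mul_of_one_le_right' hdist
    _ = (M + B) * dist1 y₁ y₂ := (add_mul _ _ _).symm
  exact_mod_cast hle

theorem IsGapOfRange.pos (hgap : IsGapOfRange N C r a) : 0 < r := by
  obtain ⟨-, ⟨ρ, hρ, -⟩, -⟩ := hgap
  exact Nat.zero_lt_of_lt hρ

theorem IsGapOfRange.exists_not_tracks (hgap : IsGapOfRange N C r a) (hh : LinearGrowth N h) :
    ∃ Y f, IsComponent (S.unflawed r a) Y ∧ C.IsPotentialOn r a Y f ∧ ¬ Tracks N Y f h := by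
  obtain ⟨-, ⟨ρ, hρ, hC⟩, Y₁, Y₂, ⟨hY₁, -⟩, ⟨hY₂, -⟩, hne, hπ₁, hπ₂, p₁, hp₁, p₂, hp₂, htop⟩ := hgap
  by_contra! htracks
  obtain ⟨M, B, hMB⟩ := Tracks.exists_linear_bound hh
    (htracks Y₁ _ hY₁ (Cocycle.isPotentialOn_diffWithin hC hρ hY₁ hπ₁ hp₁))
    (htracks Y₂ _ hY₂ (Cocycle.isPotentialOn_diffWithin hC hρ hY₂ hπ₂ hp₂))
  refine tilt_ne_top (M := M) (B := B) (hY₁.disjoint hY₂ hne) (fun y₁ hy₁ y₂ hy₂ => ?_) htop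
  obtain ⟨ζ, hζ⟩ := hY₂.exists_trail hp₂ hy₂
  rw [← Cocycle.inv_diffWithin hC hρ hY₂.subset hπ₂ hζ]
  exact hMB y₁ hy₁ y₂ hy₂

theorem Cocycle.IsPotentialOn.tracks (hh : C.IsPotentialOn r a (S.unflawed r a) h)
    (hf : C.IsPotentialOn r a Y f) (hr : 0 < r) (hY : IsComponent (S.unflawed r a) Y) :
    Tracks N Y f h := by
  obtain ⟨p, hp⟩ := hY.nonempty
  obtain ⟨B, hB⟩ := N.exists_subset_ball (Set.toFinite {1, (h p)⁻¹ * f p})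
  refine ⟨0, B, fun y hy => ⟨y, (dist1_self y).le, 1, hB (.inl rfl), _, hB (.inr rfl), ?_⟩⟩
  obtain ⟨ζ, hζ⟩ := hY.exists_trail hp hy
  rw [(hh.mono le_rfl hY.subset).inv_mul_eq hf hr hY.subset hζ, one_mul, mul_inv_cancel_left]

theorem Sharp.isProjectiveComponent (hS : Sharp S a) (hY : IsComponent (S.unflawed r a) Y) :
    IsProjectiveComponent S r a Y := by
  refine ⟨hY, fun R hrR => ?_⟩
  obtain ⟨K, hK⟩ := hS r R hrR
  obtain ⟨y, hy⟩ := hY.nonempty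
  obtain ⟨x, hx, ζ, hζ, -⟩ := hK y (hY.subset hy)
  exact ⟨x, (hY.restrict_trail hy hζ).right_mem, hx⟩

theorem Cocycle.IsPotentialOn.tracks_of_sharp [Finite A] [DiscreteTopology G] (hS : Sharp S a)
    (hF : FinitelyManyDomains S a) (hh : C.IsPotentialOn R a (S.unflawed R a) h)
    (hf : C.IsPotentialOn r a Y f) (hr : 0 < r) (hrR : r ≤ R)
    (hY : IsComponent (S.unflawed r a) Y) : Tracks N Y f h := by
  have hfin : ((fun x => (h x)⁻¹ * f x) '' (Y ∩ S.unflawed R a)).Finite := by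
    refine finite_image_of_finite_components
      ((hF R).subset fun Z => hS.isProjectiveComponent) Set.inter_subset_right
      fun x hx y _ ζ hζ => ?_
    have hζY : IsTrail Y x y ζ :=
      hY.restrict_trail hx.1 (hζ.mono (Subshift.unflawed_anti hrR))
    exact (hh.mono le_rfl Set.inter_subset_right).inv_mul_eq
      (hf.mono hrR Set.inter_subset_left) (hr.trans_le hrR) Set.inter_subset_right (hζY.inter hζ)
  obtain ⟨B, hB⟩ := N.exists_subset_ball hfin
  obtain ⟨M, hM⟩ := hf.exists_bound_along_trails N hr hY.subset
  obtain ⟨K, hK⟩ := hS r R hrR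
  refine ⟨K, max (M * (K + 1 : ℕ)) B, fun y hy => ?_⟩
  obtain ⟨x, hx, ζ, hζ, hlen⟩ := hK y (hY.subset hy)
  have hζY : IsTrail Y y x ζ := hY.restrict_trail hy hζ
  have hu : f y * (f x)⁻¹ ∈ N.ball (M * (K + 1 : ℕ)) := by
    have hball := hM x y _ hζY.reverse
    rw [List.length_reverse] at hball
    exact Pseudonorm.ball_mono (by gcongr) hball
  refine ⟨x, Nat.le_of_lt_succ (hζ.dist1_lt_length.trans_le hlen), _,
    Pseudonorm.ball_mono (le_max_left _ _) hu, _,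
    Pseudonorm.ball_mono (le_max_right _ _) (hB ⟨x, ⟨hζY.right_mem, hx⟩, rfl⟩), ?_⟩
  group

theorem not_gap_of_forall_exists_potential [Finite A] [DiscreteTopology G]
    (hpot : ∀ C : Cocycle S G, ∃ R h, LinearGrowth N h ∧ C.IsPotentialOn R a (S.unflawed R a) h) :
    ¬ (HasGap S N a ∨ HasSharpGap S N a) := by
  rintro (⟨C, hC⟩ | ⟨hS, hF, C, r, hgap⟩)
  · obtain ⟨R, h, hg, hh⟩ := hpot C
    obtain ⟨r, hRr, hgap⟩ := hC R
    obtain ⟨Y, f, hY, hf, hnot⟩ := hgap.exists_not_tracks hg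
    exact hnot ((hh.mono hRr (Subshift.unflawed_anti hRr)).tracks hf hgap.pos hY)
  · obtain ⟨R, h, hg, hh⟩ := hpot C
    obtain ⟨Y, f, hY, hf, hnot⟩ := hgap.exists_not_tracks hg
    have hmono := hh.mono (le_max_right r R) (Subshift.unflawed_anti (le_max_right r R))
    exact hnot (hmono.tracks_of_sharp hS hF hf hgap.pos (le_max_left r R) hY)

theorem mem_slightlyDefective_of_gap (ha : HasGap S N a ∨ HasSharpGap S N a) :
    a ∈ S.slightlyDefective := by
  rcases ha with ⟨C, hC⟩ | ⟨-, -, C, r, hgap⟩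
  · obtain ⟨r, -, hgap⟩ := hC 0
    exact hgap.1
  · exact hgap.1

variable [Finite A] [DiscreteTopology A] [DiscreteTopology G] [IsTopologicalGroup G]
  {Φ : CellularAutomaton D A}

theorem exists_potential_of_removable_toFun (hΦ : Φ.Preserves S)
    (hsurj : Function.Surjective (Φ.inducedMap hΦ : H1dy S G → H1dy S G))
    (ha : S.Removable (Φ.toFun a)) (N : Pseudonorm G) (C : Cocycle S G) :
    ∃ R h, LinearGrowth N h ∧ C.IsPotentialOn R a (S.unflawed R a) h := by
  obtain ⟨c, hc⟩ := hsurj (Quotient.mk _ C)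
  obtain ⟨C', rfl⟩ := Quotient.exists_rep c
  have hcoh : (Φ.pullCocycle hΦ C').Cohomologous C := Quotient.exact hc
  obtain ⟨_, x, hx⟩ := Cocycle.IsPotentialOn.exists_of_removable C' ha
  obtain ⟨_, hpull⟩ := hx.pullCocycle hΦ
  obtain ⟨R, β, hβ, hC⟩ := hpull.of_cohomologous hcoh
  exact ⟨R, _, (C'.linearGrowth_orbit N x).mul_left hβ, hC⟩

theorem essential_toFun_of_gap (hΦ : Φ.Preserves S)
    (hsurj : Function.Surjective (Φ.inducedMap hΦ : H1dy S G → H1dy S G))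
    (ha : HasGap S N a ∨ HasSharpGap S N a) : S.Essential (Φ.toFun a) :=
  ⟨Φ.toFun_mem_slightlyDefective hΦ (mem_slightlyDefective_of_gap ha), fun hrem =>
    not_gap_of_forall_exists_potential
      (exists_potential_of_removable_toFun hΦ hsurj hrem N) ha⟩

end Gaps

end CADefects

theorem theorem2p10_general {D : ℕ} {A : Type*} [Finite A] [TopologicalSpace A]
    [DiscreteTopology A] {G : Type*} [Group G] [TopologicalSpace G] [DiscreteTopology G]
    [IsTopologicalGroup G] (S : CADefects.Subshift D A) (N : CADefects.Pseudonorm G)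
    (Φ : CADefects.CellularAutomaton D A) (hΦ : Φ.Preserves S)
    (hsurj : Function.Surjective (Φ.inducedMap hΦ : CADefects.H1dy S G → CADefects.H1dy S G))
    {a : CADefects.Config D A} (ha : CADefects.HasGap S N a ∨ CADefects.HasSharpGap S N a)
    (t : ℕ) : S.Essential (Φ.toFun^[t] a) := by
  refine CADefects.essential_toFun_of_gap (Φ := Φ.iterate t) (hΦ.iterate t) ?_ ha
  rw [Φ.inducedMap_iterate hΦ]
  exact hsurj.iterate t

theorem theorem2p10 {D : ℕ} {A : Type*} [Finite A] [TopologicalSpace A] [DiscreteTopology A]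
    {G : Type*} [Group G] [TopologicalSpace G] [DiscreteTopology G] [IsTopologicalGroup G]
    (S : CADefects.Subshift D A) (N : CADefects.Pseudonorm G) :
    (∀ a, CADefects.HasGap S N a ∨ CADefects.HasSharpGap S N a → S.Essential a) ∧
    (∀ (Φ : CADefects.CellularAutomaton D A) (hΦ : Φ.Preserves S),
      Function.Surjective (Φ.inducedMap hΦ : CADefects.H1dy S G → CADefects.H1dy S G) →
        ∀ a, CADefects.HasGap S N a ∨ CADefects.HasSharpGap S N a → S.Persistent Φ a) := by
  refine ⟨fun a ha => ?_, fun Φ hΦ hsurj a ha t =>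
    (theorem2p10_general S N Φ hΦ hsurj ha t).defective⟩
  exact theorem2p10_general S N ⟨id, continuous_id, fun _ _ => rfl⟩ (fun _ hx => hx)
    (fun c => ⟨c, Quotient.inductionOn c fun _ => rfl⟩) ha 0
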